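/- For $r>0$ let $S(r)=\sum_{n\ge 1}\frac{2n}{(n^2+r^2)^2}$ be the Mathieu series (which converges), and for real $c$ put $$F_c(r)=\frac{1}{r^2+\frac12-\frac{4r^2+1}{12}\,(r^2+c)^{-1}}.$$ Let $a=\frac{\zeta(3)}{6\zeta(3)-6}=0.9915168156\ldots$, where $\zeta$ is the Riemann zeta function, and $b=\frac{13}{30}$. Then $$F_a(r)<S(r)<F_b(r)\qquad\text{for all } r>0,$$ and both constants are best possible: if a real number $a'$ satisfies $F_{a'}(r)<S(r)$ for all $r>0$, then $a'\ge a$; and if a real number $b'$ satisfies $S(r)<F_{b'}(r)$ for all $r>0$, then $b'\le b$. -/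

import Mathlib

/-- The `n`-th term, `n = 0, 1, 2, …`, of the Mathieu series; the index is shifted by one, so
that it is the term `2m / (m ^ 2 + r ^ 2) ^ 2` with `m = n + 1`. -/
noncomputable def mathieuTerm (r : ℝ) (n : ℕ) : ℝ :=
  2 * ((n : ℝ) + 1) / (((n : ℝ) + 1) ^ 2 + r ^ 2) ^ 2

/-- The sum `S(r)` of the Mathieu series. -/
noncomputable def mathieuS (r : ℝ) : ℝ := ∑' n : ℕ, mathieuTerm r n

/-- The bounding function with parameter `c`. -/
noncomputable def mathieuBound (c r : ℝ) : ℝ :=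
  1 / (r ^ 2 + 1 / 2 - (4 * r ^ 2 + 1) / 12 * (r ^ 2 + c)⁻¹)

/-- The constant `ζ(3) / (6 ζ(3) - 6)`. -/
noncomputable def mathieuA : ℝ :=
  (riemannZeta 3).re / (6 * (riemannZeta 3).re - 6)

/-! ### Comparison of a series with a telescoping one -/

/-! Write `t = r ^ 2` and `x = m ^ 2 - m + t`. The differences of `1 / (x + 1/2)` in `m` are `2m /
((m ^ 2 + t) ^ 2 + t + 1/4)`, nearly the Mathieu term. Refining to `1 / (x + 1/2 - (4t+1)/12 / (x +
3/2 - w))` gives telescopers on either side of it: `w = (16/15) t / (x + 1/2)` stays below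
(`lowerTelescoper_sub_lt`), and `w = x (16t/15 + 8/5) / (x ^ 2 + 7x/2 - 2t)` stays above
(`lt_upperTelescoper_sub`). At `m = 1`, where `x = t`, the upper telescoper is exactly the bound
with `c = 13/30`, and the lower one is the bound with `c = 13/30 + (8/15) / (t + 1/2)`. Since the
bound decreases in `c` and this `c` tends to `13/30` as `r` grows, `13/30` is optimal; for `t ≥ 1/2`
this `c` is below `mathieuA`, which gives the lower bound there. The constant `mathieuA` is the one
for which the bound at `r = 0` equals `S(0) = 2 ζ(3)`. For `t ≤ 1/2` both sides are compared with
`S(0)`, the terms after the first being replaced by their tangent lines in `t`. A smaller constant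
makes the bound reach `S(0) ≥ S(r)` at some `r > 0`. -/

theorem tsum_le_of_le_telescope {f H : ℕ → ℝ} (hf : Summable f)
    (hH : Filter.Tendsto H Filter.atTop (nhds 0)) (h : ∀ n, f n ≤ H n - H (n + 1)) :
    ∑' n, f n ≤ H 0 := by
  have h1 := hf.hasSum.tendsto_sum_nat
  have h2 : Filter.Tendsto (fun n => H 0 - H n) Filter.atTop (nhds (H 0 - 0)) :=
    tendsto_const_nhds.sub hH
  rw [sub_zero] at h2
  refine le_of_tendsto_of_tendsto' h1 h2 fun n => ?_
  rw [← Finset.sum_range_sub']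
  exact Finset.sum_le_sum fun i _ => h i

theorem le_tsum_of_telescope_le {f H : ℕ → ℝ} (hf : Summable f)
    (hH : Filter.Tendsto H Filter.atTop (nhds 0)) (h : ∀ n, H n - H (n + 1) ≤ f n) :
    H 0 ≤ ∑' n, f n := by
  have := tsum_le_of_le_telescope (f := fun n => - f n) (H := fun n => - H n) hf.neg
    (by simpa using hH.neg) (fun n => by linarith [h n])
  rw [tsum_neg] at this
  linarith

theorem tsum_lt_of_lt_telescope {f H : ℕ → ℝ} (hf : Summable f)
    (hH : Filter.Tendsto H Filter.atTop (nhds 0)) (h : ∀ n, f n < H n - H (n + 1)) :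
    ∑' n, f n < H 0 := by
  -- Passing to the limit loses strictness, so the initial term is split off and supplies it.
  have h1 := tsum_le_of_le_telescope (f := fun n => f (n + 1)) (H := fun n => H (n + 1))
    ((summable_nat_add_iff 1).2 hf) (hH.comp (Filter.tendsto_add_atTop_nat 1))
    (fun n => (h (n + 1)).le)
  rw [hf.tsum_eq_zero_add]
  have := h 0
  simp only [zero_add] at *
  linarith

theorem lt_tsum_of_telescope_lt {f H : ℕ → ℝ} (hf : Summable f)
    (hH : Filter.Tendsto H Filter.atTop (nhds 0)) (h : ∀ n, H n - H (n + 1) < f n) :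
    H 0 < ∑' n, f n := by
  have := tsum_lt_of_lt_telescope (f := fun n => - f n) (H := fun n => - H n) hf.neg
    (by simpa using hH.neg) (fun n => by linarith [h n])
  rw [tsum_neg] at this
  linarith

/-- A nonnegative sequence bounded by a multiple of `1 / (n + 1)` tends to zero. -/
theorem tendsto_zero_of_le_div_succ {H : ℕ → ℝ} {C : ℝ} (h0 : ∀ n, 0 ≤ H n)
    (h1 : ∀ n, H n ≤ C * (1 / ((n : ℝ) + 1))) : Filter.Tendsto H Filter.atTop (nhds 0) :=
  squeeze_zero h0 h1 (by simpa using tendsto_one_div_add_atTop_nhds_zero_nat.const_mul C)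

/-! ### The terms of the series -/

theorem mathieuTerm_nonneg (r : ℝ) (n : ℕ) : 0 ≤ mathieuTerm r n := by
  unfold mathieuTerm; positivity

theorem mathieuTerm_le_zero (r : ℝ) (n : ℕ) : mathieuTerm r n ≤ mathieuTerm 0 n := by
  unfold mathieuTerm
  refine div_le_div_of_nonneg_left (by positivity) (by positivity) ?_
  refine pow_le_pow_left₀ (by positivity) ?_ 2
  nlinarith [sq_nonneg r]

theorem mathieuTerm_zero (n : ℕ) : mathieuTerm 0 n = 2 * (1 / ((n : ℝ) + 1) ^ 3) := by
  unfold mathieuTerm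
  field_simp
  ring

theorem summable_mathieuTerm (r : ℝ) : Summable (mathieuTerm r) := by
  have h : Summable fun n : ℕ => 1 / ((n : ℝ) + 1) ^ 3 := by
    have := (summable_nat_add_iff 1).2 (Real.summable_one_div_nat_pow.2 (by norm_num : 1 < 3))
    simpa using this
  refine Summable.of_nonneg_of_le (mathieuTerm_nonneg r) (fun n => ?_) (h.mul_left 2)
  rw [← mathieuTerm_zero]
  exact mathieuTerm_le_zero r n

theorem mathieuS_le_zero (r : ℝ) : mathieuS r ≤ mathieuS 0 :=
  (summable_mathieuTerm r).tsum_le_tsum (mathieuTerm_le_zero r) (summable_mathieuTerm 0)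

theorem mathieuS_zero : mathieuS 0 = 2 * (riemannZeta 3).re := by
  have h : riemannZeta 3 = ((∑' n : ℕ, 1 / ((n : ℝ) + 1) ^ 3 : ℝ) : ℂ) := by
    have h3 := zeta_eq_tsum_one_div_nat_add_one_cpow (s := 3) (by norm_num)
    rw [h3, Complex.ofReal_tsum]
    refine tsum_congr fun n => ?_
    push_cast
    norm_cast
  rw [h, Complex.ofReal_re, ← tsum_mul_left]
  exact tsum_congr mathieuTerm_zero

/-! ### The telescoping lower bound -/

/-- Numerator of the lower telescoper; the variable `x` stands for `m ^ 2 - m + t`. -/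
noncomputable def lowerNum (t x : ℝ) : ℝ := (x + 3 / 2) * (x + 1 / 2) - 16 / 15 * t

/-- Denominator of the lower telescoper. -/
noncomputable def lowerDen (t x : ℝ) : ℝ := (x + 1 / 2) * (lowerNum t x - (4 * t + 1) / 12)

/-- The function of `m` whose differences are smaller than the terms of the Mathieu series. -/
noncomputable def lowerTelescoper (t m : ℝ) : ℝ :=
  lowerNum t (m ^ 2 - m + t) / lowerDen t (m ^ 2 - m + t)

theorem lowerDen_pos {t m : ℝ} (ht : 0 ≤ t) (hm : 1 ≤ m) : 0 < lowerDen t (m ^ 2 - m + t) := by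
  obtain ⟨z, hz⟩ : ∃ z, z = m ^ 2 - m := ⟨_, rfl⟩
  have hz0 : 0 ≤ z := by nlinarith
  rw [← hz]
  have : lowerDen t (z + t) = (z + t + 1 / 2) * ((z + t) ^ 2 + 2 * z + 3 / 5 * t + 2 / 3) := by
    unfold lowerDen lowerNum; ring
  rw [this]; positivity

/-- After clearing denominators the surplus is exactly the polynomial `hE`, where a completed square
makes positivity visible. -/
theorem lowerTelescoper_sub_lt {t m : ℝ} (ht : 0 ≤ t) (hm : 1 ≤ m) :
    lowerTelescoper t m - lowerTelescoper t (m + 1) < 2 * m / (m ^ 2 + t) ^ 2 := by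
  have h1 := lowerDen_pos ht hm
  have h2 := lowerDen_pos ht (by linarith : 1 ≤ m + 1)
  have hE : 0 < m * (8 / 9 * (4 * t + 1) * (m ^ 2 - 4 / 5 * t) ^ 2 + 8 / 5 * t ^ 2
      + 58 / 45 * t + 2 / 9) := by positivity
  unfold lowerTelescoper
  rw [div_sub_div _ _ h1.ne' h2.ne', div_lt_div_iff₀ (mul_pos h1 h2) (by positivity)]
  rw [← sub_pos]
  refine hE.trans_eq ?_
  unfold lowerDen lowerNum
  ring

theorem lowerTelescoper_nonneg {t m : ℝ} (ht : 0 ≤ t) (hm : 1 ≤ m) : 0 ≤ lowerTelescoper t m := by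
  refine div_nonneg ?_ (lowerDen_pos ht hm).le
  have : 0 ≤ m ^ 2 - m := by nlinarith
  unfold lowerNum
  nlinarith [mul_nonneg this ht, sq_nonneg (m ^ 2 - m)]

theorem lowerTelescoper_le {t m : ℝ} (ht : 0 ≤ t) (hm : 1 ≤ m) :
    lowerTelescoper t m ≤ 4 / m := by
  have h1 := lowerDen_pos ht hm
  have hx : 0 ≤ m ^ 2 - m := by nlinarith
  have hx2 : m ≤ 2 * (m ^ 2 - m + t + 1 / 2) := by nlinarith
  have hP : lowerNum t (m ^ 2 - m + t) ≤
      2 * (lowerNum t (m ^ 2 - m + t) - (4 * t + 1) / 12) := by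
    unfold lowerNum
    nlinarith [mul_nonneg hx ht, sq_nonneg (m ^ 2 - m)]
  have hP0 : 0 ≤ lowerNum t (m ^ 2 - m + t) - (4 * t + 1) / 12 := by linarith
  unfold lowerTelescoper
  rw [div_le_div_iff₀ h1 (by positivity)]
  unfold lowerDen
  calc _ ≤ 2 * (lowerNum t (m ^ 2 - m + t) - (4 * t + 1) / 12) * m := by gcongr
    _ ≤ 2 * (lowerNum t (m ^ 2 - m + t) - (4 * t + 1) / 12) *
        (2 * (m ^ 2 - m + t + 1 / 2)) := by gcongr
    _ = _ := by ring

/-- `N = 0` serves the bound for the whole sum, `N = 12` the numerical value of `ζ(3)`. -/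
theorem lowerTelescoper_lt_tail (r : ℝ) (N : ℕ) :
    lowerTelescoper (r ^ 2) (N + 1) < ∑' n, mathieuTerm r (n + N) := by
  have hpos (n : ℕ) : (1 : ℝ) ≤ n + N + 1 := by
    have : (0 : ℝ) ≤ (n : ℝ) + N := by positivity
    linarith
  have := lt_tsum_of_telescope_lt (f := fun n => mathieuTerm r (n + N))
    (H := fun n => lowerTelescoper (r ^ 2) (n + N + 1))
    ((summable_nat_add_iff N).2 (summable_mathieuTerm r))
    (tendsto_zero_of_le_div_succ (C := 4)
      (fun n => lowerTelescoper_nonneg (sq_nonneg r) (hpos n))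
      (fun n => (lowerTelescoper_le (sq_nonneg r) (hpos n)).trans (by
        rw [← mul_one_div]
        gcongr
        simp)))
    (fun n => by
      have := lowerTelescoper_sub_lt (sq_nonneg r) (hpos n)
      simp only [mathieuTerm]
      push_cast
      convert this using 2
      ring_nf)
  simpa using this

/-! ### The telescoping upper bound -/

/-- The quadratic that occurs in the upper telescoper. -/
noncomputable def upperQuad (t x : ℝ) : ℝ := x ^ 2 + 7 / 2 * x - 2 * t

/-- Numerator of the upper telescoper; the variable `x` stands for `m ^ 2 - m + t`. -/
noncomputable def upperNum (t x : ℝ) : ℝ :=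
  (x + 3 / 2) * upperQuad t x - x * (16 / 15 * t + 8 / 5)

/-- Denominator of the upper telescoper. -/
noncomputable def upperDen (t x : ℝ) : ℝ :=
  (x + 1 / 2) * upperNum t x - (4 * t + 1) / 12 * upperQuad t x

/-- The function of `m` whose differences are larger than the terms of the Mathieu series. -/
noncomputable def upperTelescoper (t m : ℝ) : ℝ :=
  upperNum t (m ^ 2 - m + t) / upperDen t (m ^ 2 - m + t)

theorem upperNum_nonneg {t z : ℝ} (ht : 0 ≤ t) (hz : 0 ≤ z) : 0 ≤ upperNum t (z + t) := by
  have : upperNum t (z + t) =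
      13 / 20 * t + 29 / 15 * t ^ 2 + t ^ 3 + 73 / 20 * z + 104 / 15 * z * t
        + 3 * z * t ^ 2 + 5 * z ^ 2 + 3 * z ^ 2 * t + z ^ 3 := by unfold upperNum upperQuad; ring
  rw [this]; positivity

theorem upperNum_mul_le {t z : ℝ} (ht : 0 ≤ t) (hz : 0 ≤ z) :
    upperNum t (z + t) * (z + t) ≤ upperDen t (z + t) := by
  have : upperDen t (z + t) - upperNum t (z + t) * (z + t) =
      1 / 5 * t + 23 / 60 * t ^ 2 + 1 / 6 * t ^ 3 + 23 / 15 * z + 32 / 15 * z * t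
        + 5 / 6 * z * t ^ 2 + 29 / 12 * z ^ 2 + 7 / 6 * z ^ 2 * t + 1 / 2 * z ^ 3 := by
    unfold upperDen upperNum upperQuad; ring
  rw [← sub_nonneg, this]; positivity

theorem upperDen_pos {t z : ℝ} (ht : 0 ≤ t) (hz : 0 ≤ z) (h : 0 < z ∨ 0 < t) :
    0 < upperDen t (z + t) := by
  have : upperDen t (z + t) =
      1 / 5 * t + 31 / 30 * t ^ 2 + 21 / 10 * t ^ 3 + t ^ 4 + 23 / 15 * z
        + 193 / 30 * z * t + 97 / 10 * z * t ^ 2 + 4 * z * t ^ 3 + 91 / 15 * z ^ 2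
        + 131 / 10 * z ^ 2 * t + 6 * z ^ 2 * t ^ 2 + 11 / 2 * z ^ 3
        + 4 * z ^ 3 * t + z ^ 4 := by
    unfold upperDen upperNum upperQuad; ring
  rw [this]
  rcases h with h | h <;> positivity

/-- At `m = 1`, `t = 0` the denominator `upperDen` vanishes, hence the condition `0 < t` there. -/
theorem lt_upperTelescoper_sub {t m : ℝ} (ht : 0 ≤ t) (hm : m = 1 ∧ 0 < t ∨ 2 ≤ m) :
    2 * m / (m ^ 2 + t) ^ 2 < upperTelescoper t m - upperTelescoper t (m + 1) := by
  have h1 : 0 < upperDen t (m ^ 2 - m + t) := by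
    refine upperDen_pos ht ?_ ?_
    · rcases hm with ⟨rfl, h⟩ | h
      · norm_num
      · nlinarith
    · rcases hm with ⟨rfl, h⟩ | h
      · exact Or.inr h
      · left; nlinarith
  have h2 : 0 < upperDen t ((m + 1) ^ 2 - (m + 1) + t) := by
    refine upperDen_pos ht ?_ (Or.inl ?_) <;> rcases hm with ⟨rfl, h⟩ | h <;> nlinarith
  have hm0 : 0 < m := by rcases hm with ⟨rfl, h⟩ | h <;> linarith
  unfold upperTelescoper
  rw [div_sub_div _ _ h1.ne' h2.ne', div_lt_div_iff₀ (by positivity) (mul_pos h1 h2)]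
  rw [← sub_pos]
  rcases hm with ⟨rfl, h⟩ | h
  · have hE : 0 < 1108 / 75 * t + 3166 / 45 * t ^ 2 + 10366 / 225 * t ^ 3 + 932 / 225 * t ^ 4
        + 16 / 75 * t ^ 5 := by positivity
    refine hE.trans_eq ?_
    unfold upperDen upperNum upperQuad
    ring
  -- Apart from a factor `m` the surplus is even in `m`; expanded in `q = m ^ 2 - 4 ≥ 0` and `t` it
  -- has only positive coefficients.
  · obtain ⟨q, hq⟩ : ∃ q, q = m ^ 2 - 4 := ⟨_, rfl⟩
    have hq0 : 0 ≤ q := by nlinarith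
    have hE : 0 < m * (11768 / 75 + 58088 / 75 * t + 148526 / 225 * t ^ 2 + 66238 / 225 * t ^ 3
        + 724 / 45 * t ^ 4 + 16 / 75 * t ^ 5 + 37394 / 225 * q
        + 169222 / 225 * q * t + 5648 / 15 * q * t ^ 2 + 2752 / 25 * q * t ^ 3
        + 896 / 225 * q * t ^ 4 + 13942 / 225 * q ^ 2 + 60214 / 225 * q ^ 2 * t
        + 18296 / 225 * q ^ 2 * t ^ 2 + 2048 / 225 * q ^ 2 * t ^ 3
        + 28 / 3 * q ^ 3 + 352 / 9 * q ^ 3 * t + 64 / 9 * q ^ 3 * t ^ 2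
        + 4 / 9 * q ^ 4 + 16 / 9 * q ^ 4 * t) := by positivity
    refine hE.trans_eq ?_
    rw [hq]
    unfold upperDen upperNum upperQuad
    ring

theorem upperTelescoper_nonneg {t m : ℝ} (ht : 0 ≤ t) (hm : 2 ≤ m) : 0 ≤ upperTelescoper t m :=
  div_nonneg (upperNum_nonneg ht (by nlinarith))
    (upperDen_pos ht (by nlinarith) (Or.inl (by nlinarith))).le

theorem upperTelescoper_le {t m : ℝ} (ht : 0 ≤ t) (hm : 2 ≤ m) :
    upperTelescoper t m ≤ 2 / m := by
  have hz : 0 ≤ m ^ 2 - m := by nlinarith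
  have h1 : 0 < upperDen t (m ^ 2 - m + t) := upperDen_pos ht hz (Or.inl (by nlinarith))
  have h2 := upperNum_mul_le ht hz
  have h3 := upperNum_nonneg ht hz
  have hx : m ≤ 2 * (m ^ 2 - m + t) := by nlinarith
  unfold upperTelescoper
  rw [div_le_div_iff₀ h1 (by positivity)]
  nlinarith [mul_le_mul_of_nonneg_left hx h3]

theorem tail_lt_upperTelescoper (r : ℝ) {N : ℕ} (hN : 1 ≤ N) :
    ∑' n, mathieuTerm r (n + N) < upperTelescoper (r ^ 2) (N + 1) := by
  have hpos (n : ℕ) : (2 : ℝ) ≤ n + N + 1 := by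
    have : (1 : ℝ) ≤ N := by exact_mod_cast hN
    linarith [(Nat.cast_nonneg n : (0 : ℝ) ≤ n)]
  have := tsum_lt_of_lt_telescope (f := fun n => mathieuTerm r (n + N))
    (H := fun n => upperTelescoper (r ^ 2) (n + N + 1))
    ((summable_nat_add_iff N).2 (summable_mathieuTerm r))
    (tendsto_zero_of_le_div_succ (C := 2)
      (fun n => upperTelescoper_nonneg (sq_nonneg r) (hpos n))
      (fun n => (upperTelescoper_le (sq_nonneg r) (hpos n)).trans (by
        rw [← mul_one_div]
        gcongr
        simp)))
    (fun n => by
      have := lt_upperTelescoper_sub (sq_nonneg r) (Or.inr (hpos n))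
      simp only [mathieuTerm]
      push_cast
      convert this using 2
      ring_nf)
  simpa using this

/-! ### Numerical bounds -/

theorem mathieuS_eq_sum_add_tail (r : ℝ) (N : ℕ) :
    mathieuS r = ∑ n ∈ Finset.range N, mathieuTerm r n + ∑' n, mathieuTerm r (n + N) :=
  ((summable_mathieuTerm r).sum_add_tsum_nat_add N).symm

theorem lt_zeta_three : 1.202056903138090 < (riemannZeta 3).re := by
  -- At `r = 0` the series is `2 ζ(3)`: twelve explicit terms plus the telescoping estimate of the
  -- tail.
  have h := lowerTelescoper_lt_tail 0 12
  have h1 := mathieuS_eq_sum_add_tail 0 12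
  rw [mathieuS_zero] at h1
  generalize ∑' n, mathieuTerm 0 (n + 12) = T at h h1
  norm_num [Finset.sum_range_succ, mathieuTerm] at h1
  norm_num [lowerTelescoper, lowerNum, lowerDen] at h
  norm_num
  linarith

theorem zeta_three_lt : (riemannZeta 3).re < 1.202056903162585 := by
  have h := tail_lt_upperTelescoper 0 (N := 12) (by norm_num)
  have h1 := mathieuS_eq_sum_add_tail 0 12
  rw [mathieuS_zero] at h1
  generalize ∑' n, mathieuTerm 0 (n + 12) = T at h h1
  norm_num [Finset.sum_range_succ, mathieuTerm] at h1
  norm_num [upperTelescoper, upperNum, upperDen, upperQuad] at h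
  norm_num
  linarith

theorem le_mathieuA : 0.9915168156 ≤ mathieuA := by
  have h1 := lt_zeta_three
  have h2 := zeta_three_lt
  unfold mathieuA
  rw [le_div_iff₀ (by norm_num at *; linarith)]
  norm_num at *
  linarith

theorem mathieuA_lt : mathieuA < 0.9915168157 := by
  have h1 := lt_zeta_three
  have h2 := zeta_three_lt
  unfold mathieuA
  rw [div_lt_iff₀ (by norm_num at *; linarith)]
  norm_num at *
  linarith

theorem mathieuS_zero_bounds : 2.4041 < mathieuS 0 ∧ mathieuS 0 < 2.4042 := by
  have h1 := lt_zeta_three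
  have h2 := zeta_three_lt
  rw [mathieuS_zero]
  norm_num at *
  constructor <;> linarith

/-- The relation that characterises the constant `mathieuA`. -/
theorem mathieuA_mul : mathieuA * (mathieuS 0 / 2 - 1) = mathieuS 0 / 12 := by
  have h1 := lt_zeta_three
  have : (riemannZeta 3).re - 1 ≠ 0 := by norm_num at *; linarith
  rw [mathieuS_zero, mathieuA, show 6 * (riemannZeta 3).re - 6 = 6 * ((riemannZeta 3).re - 1) by ring]
  field_simp
  ring

/-! ### The bounds for the sum -/

theorem mathieuBound_den_pos {c t : ℝ} (hc : 13 / 30 ≤ c) (ht : 0 ≤ t) :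
    0 < t + 1 / 2 - (4 * t + 1) / 12 * (t + c)⁻¹ := by
  have : 0 < t + c := by linarith
  rw [sub_pos, ← div_eq_mul_inv, div_lt_iff₀ this]
  nlinarith [mul_nonneg ht ht]

theorem mathieuBound_anti {c d : ℝ} (hc : 13 / 30 ≤ c) (hcd : c < d) (r : ℝ) :
    mathieuBound d r < mathieuBound c r := by
  have hr := sq_nonneg r
  unfold mathieuBound
  refine one_div_lt_one_div_of_lt (mathieuBound_den_pos hc hr) ?_
  have h1 : 0 < r ^ 2 + c := by linarith
  have : (r ^ 2 + d)⁻¹ < (r ^ 2 + c)⁻¹ := inv_strictAnti₀ h1 (by linarith)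
  have h2 : 0 < (4 * r ^ 2 + 1) / 12 := by positivity
  nlinarith

theorem mathieuS_lt_mathieuBound {r : ℝ} (hr : 0 < r) : mathieuS r < mathieuBound (13 / 30) r := by
  have ht : 0 < r ^ 2 := by positivity
  have h1 := mathieuS_eq_sum_add_tail r 1
  have h2 := tail_lt_upperTelescoper r le_rfl
  have h3 := lt_upperTelescoper_sub ht.le (Or.inl ⟨rfl, ht⟩)
  -- At `x = t` the quadratic is `t (t + 3/2)`, so the inner fraction `w` collapses to `16/15`, and
  -- `3/2 - 16/15 = 13/30`.
  have h4 : upperTelescoper (r ^ 2) 1 = mathieuBound (13 / 30) r := by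
    have h5 := mathieuBound_den_pos (c := 13 / 30) le_rfl ht.le
    have h6 : 0 < upperDen (r ^ 2) (1 ^ 2 - 1 + r ^ 2) :=
      upperDen_pos ht.le (by norm_num) (Or.inr ht)
    have h7 : 0 < r ^ 2 + 13 / 30 := by linarith
    unfold upperTelescoper mathieuBound
    rw [div_eq_div_iff h6.ne' h5.ne']
    unfold upperDen upperNum upperQuad
    field_simp
    ring
  rw [← h4]
  simp only [Finset.sum_range_one, mathieuTerm, Nat.cast_zero, zero_add, Nat.cast_one] at *
  linarith

theorem mathieuBound_lt_mathieuS_of_sq (r : ℝ) :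
    mathieuBound (13 / 30 + 8 / 15 / (r ^ 2 + 1 / 2)) r < mathieuS r := by
  have ht := sq_nonneg r
  have h1 := mathieuS_eq_sum_add_tail r 0
  have h2 := lowerTelescoper_lt_tail r 0
  -- Here `w = (16/15) t / (t + 1/2) = 16/15 - (8/15) / (t + 1/2)`.
  have h4 : lowerTelescoper (r ^ 2) 1 =
      mathieuBound (13 / 30 + 8 / 15 / (r ^ 2 + 1 / 2)) r := by
    have hc : (13 : ℝ) / 30 ≤ 13 / 30 + 8 / 15 / (r ^ 2 + 1 / 2) :=
      le_add_of_nonneg_right (by positivity)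
    have h5 := mathieuBound_den_pos hc ht
    have h6 := lowerDen_pos ht (m := 1) le_rfl
    have h7 : 0 < r ^ 2 + (13 / 30 + 8 / 15 / (r ^ 2 + 1 / 2)) := by positivity
    unfold lowerTelescoper mathieuBound
    rw [div_eq_div_iff h6.ne' h5.ne']
    unfold lowerDen lowerNum
    field_simp
    ring
  simp only [Finset.sum_range_zero, Nat.cast_zero, zero_add] at *
  linarith

theorem mathieuBound_lt_mathieuS_of_le_sq {r : ℝ} (hr : 1 / 2 ≤ r ^ 2) :
    mathieuBound mathieuA r < mathieuS r := by
  refine (mathieuBound_anti (le_add_of_nonneg_right (by positivity)) ?_ r).trans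
    (mathieuBound_lt_mathieuS_of_sq r)
  -- For `r ^ 2 ≥ 1/2` the parameter is at most `13/30 + 8/15 = 29/30 < mathieuA`.
  have h1 := le_mathieuA
  have : 8 / 15 / (r ^ 2 + 1 / 2) ≤ 8 / 15 := by
    rw [div_le_iff₀ (by positivity)]
    linarith
  norm_num at *
  linarith

/-! ### The lower bound near zero -/

/-- A function whose differences dominate `4 / m ^ 5`. -/
noncomputable def quinticTelescoper (m : ℝ) : ℝ := 1 / (m ^ 2 - m + 7 / 12) ^ 2

/-- For a shift `c` in place of `7/12` the difference is `4 / m ^ 5 + (8 - 12 c) / m ^ 7 + ⋯`, so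
`7/12 < 2/3` leaves a positive surplus. -/
theorem quintic_le_sub {m : ℝ} (hm : 2 ≤ m) :
    4 / m ^ 5 ≤ quinticTelescoper m - quinticTelescoper (m + 1) := by
  obtain ⟨u, rfl⟩ : ∃ u, m = u + 2 := ⟨m - 2, by ring⟩
  have hu : 0 ≤ u := by linarith
  have h1 : 0 < (u + 2) ^ 2 - (u + 2) + 7 / 12 := by ring_nf; positivity
  have h2 : 0 < (u + 2 + 1) ^ 2 - (u + 2 + 1) + 7 / 12 := by ring_nf; positivity
  unfold quinticTelescoper
  rw [div_sub_div _ _ (by positivity) (by positivity),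
    div_le_div_iff₀ (by positivity) (by positivity)]
  rw [← sub_nonneg]
  ring_nf
  positivity

/-- The term is convex in `t`, so it lies above its tangent at `t = 0`. -/
theorem sub_mul_quintic_le {t m : ℝ} (ht : 0 ≤ t) (hm : 0 < m) :
    2 / m ^ 3 - t * (4 / m ^ 5) ≤ 2 * m / (m ^ 2 + t) ^ 2 := by
  rw [mul_div_assoc', div_sub_div _ _ (by positivity) (by positivity),
    div_le_div_iff₀ (by positivity) (by positivity), ← sub_nonneg]
  have : 0 ≤ m ^ 4 * (6 * m ^ 2 * t ^ 2 + 4 * t ^ 3) / m := by positivity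
  refine this.trans_eq ?_
  field_simp
  ring

/-- The term `m = 1` is kept exact; the tangent losses for `m ≥ 2` sum to at most `r ^ 2` times
`quinticTelescoper 2`. -/
theorem mathieuS_zero_sub_le (r : ℝ) :
    mathieuS 0 - 2 + 2 / (1 + r ^ 2) ^ 2 - r ^ 2 * (144 / 961) ≤ mathieuS r := by
  have hpos (n : ℕ) : (2 : ℝ) ≤ n + 2 := by simp
  have h := tsum_le_of_le_telescope
    (f := fun n => mathieuTerm 0 (n + 1) - mathieuTerm r (n + 1))
    (H := fun n => r ^ 2 * quinticTelescoper (n + 2))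
    (((summable_nat_add_iff 1).2 (summable_mathieuTerm 0)).sub
      ((summable_nat_add_iff 1).2 (summable_mathieuTerm r)))
    (tendsto_zero_of_le_div_succ (C := r ^ 2)
      (fun n => by unfold quinticTelescoper; positivity)
      (fun n => by
        unfold quinticTelescoper
        have hn : (0 : ℝ) ≤ n := n.cast_nonneg
        gcongr
        nlinarith [mul_nonneg hn hn, mul_nonneg hn (mul_nonneg hn hn), pow_nonneg hn 4]))
    (fun n => by
      have h1 := quintic_le_sub (hpos n)
      have h2 := sub_mul_quintic_le (sq_nonneg r) (m := (n : ℝ) + 2) (by positivity)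
      have h3 := mul_le_mul_of_nonneg_left h1 (sq_nonneg r)
      have e1 : mathieuTerm 0 (n + 1) = 2 / ((n : ℝ) + 2) ^ 3 := by
        rw [mathieuTerm_zero]; push_cast; ring
      have e2 : mathieuTerm r (n + 1) = 2 * ((n : ℝ) + 2) / (((n : ℝ) + 2) ^ 2 + r ^ 2) ^ 2 := by
        unfold mathieuTerm; push_cast; ring
      have e3 : ((n + 1 : ℕ) : ℝ) + 2 = (n : ℝ) + 2 + 1 := by push_cast; ring
      rw [e1, e2, e3]
      linarith)
  rw [((summable_nat_add_iff 1).2 (summable_mathieuTerm 0)).tsum_sub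
      ((summable_nat_add_iff 1).2 (summable_mathieuTerm r))] at h
  have h0 := mathieuS_eq_sum_add_tail 0 1
  have h1 := mathieuS_eq_sum_add_tail r 1
  have hq : quinticTelescoper 2 = 144 / 961 := by norm_num [quinticTelescoper]
  simp only [Finset.sum_range_one, Nat.cast_zero, zero_add, hq] at *
  have e0 : mathieuTerm 0 0 = 2 := by norm_num [mathieuTerm]
  have e1 : mathieuTerm r 0 = 2 / (1 + r ^ 2) ^ 2 := by norm_num [mathieuTerm]
  linarith

theorem mathieuBound_lt_mathieuS_of_sq_le {r : ℝ} (hr : 0 < r) (hr2 : r ^ 2 ≤ 1 / 2) :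
    mathieuBound mathieuA r < mathieuS r := by
  refine lt_of_lt_of_le ?_ (mathieuS_zero_sub_le r)
  have ht : 0 < r ^ 2 := by positivity
  have hA1 := le_mathieuA
  have hA2 := mathieuA_lt
  obtain ⟨hZ1, hZ2⟩ := mathieuS_zero_bounds
  have hrel := mathieuA_mul
  unfold mathieuBound
  generalize r ^ 2 = t at *
  generalize mathieuA = a at *
  generalize mathieuS 0 = Z at *
  norm_num at hA1 hA2 hZ1 hZ2
  have ha : 0 < t + a := by linarith
  have hD : 0 < t ^ 2 + (a + 1 / 6) * t + (a / 2 - 1 / 12) := by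
    have : 0 < a / 2 - 1 / 12 := by linarith
    positivity
  -- By `hrel` the bound equals `Z` at `t = 0`, so a factor `t` splits off the difference.
  have hF : 1 / (t + 1 / 2 - (4 * t + 1) / 12 * (t + a)⁻¹) =
      Z - t * (Z * (t + a + 1 / 6) - 1) / (t ^ 2 + (a + 1 / 6) * t + (a / 2 - 1 / 12)) := by
    have : t + 1 / 2 - (4 * t + 1) / 12 * (t + a)⁻¹ =
      (t ^ 2 + (a + 1 / 6) * t + (a / 2 - 1 / 12)) / (t + a) := by
      field_simp
      ring
    rw [this, one_div_div, eq_sub_iff_add_eq, ← add_div, div_eq_iff hD.ne']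
    linarith
  -- This is the required comparison of the two drops from `Z`, divided by `t`, with `144/961`
  -- rounded up to `3/20`.
  have hkey : (2 * (2 + t) + 3 / 20 * (1 + t) ^ 2) *
      (t ^ 2 + (a + 1 / 6) * t + (a / 2 - 1 / 12)) <
      (1 + t) ^ 2 * (Z * (t + a + 1 / 6) - 1) := by
    have h1 : t ^ 2 + (a + 1 / 6) * t + (a / 2 - 1 / 12) ≤ t ^ 2 + 1.1582 * t + 0.41245 := by
      nlinarith
    have h2 : 2.4041 * t + 1.7843 ≤ Z * (t + a + 1 / 6) - 1 := by nlinarith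
    calc _ ≤ (2 * (2 + t) + 3 / 20 * (1 + t) ^ 2) * (t ^ 2 + 1.1582 * t + 0.41245) := by gcongr
      _ < (1 + t) ^ 2 * (2.4041 * t + 1.7843) := by
        have h3 : 0 ≤ 1 / 2 - t := by linarith
        norm_num
        nlinarith [mul_nonneg ht.le h3, mul_nonneg (mul_nonneg ht.le h3) ht.le,
          mul_nonneg (mul_nonneg ht.le h3) (mul_nonneg ht.le ht.le)]
      _ ≤ _ := by gcongr
  have h3 : 2 - 2 / (1 + t) ^ 2 + t * (144 / 961) ≤
      t * (2 * (2 + t) + 3 / 20 * (1 + t) ^ 2) / (1 + t) ^ 2 := by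
    rw [le_div_iff₀ (by positivity), add_mul, sub_mul, div_mul_cancel₀ _ (by positivity)]
    nlinarith [mul_pos ht (by positivity : 0 < (1 + t) ^ 2)]
  have h4 : t * (2 * (2 + t) + 3 / 20 * (1 + t) ^ 2) / (1 + t) ^ 2 <
      t * (Z * (t + a + 1 / 6) - 1) / (t ^ 2 + (a + 1 / 6) * t + (a / 2 - 1 / 12)) := by
    rw [div_lt_div_iff₀ (by positivity) hD]
    nlinarith [mul_lt_mul_of_pos_left hkey ht]
  rw [hF]
  linarith

/-! ### Optimality of the constants -/

theorem mathieuA_le_of_forall_lt {a : ℝ} (h : ∀ r : ℝ, 0 < r → mathieuBound a r < mathieuS r) :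
    mathieuA ≤ a := by
  by_contra! ha
  obtain ⟨hZ1, hZ2⟩ := mathieuS_zero_bounds
  have hrel := mathieuA_mul
  have hA := le_mathieuA
  have hZpos : 0 < mathieuS 0 := by norm_num at *; linarith
  -- For `t + a > 0`, a zero of `g` is a point where the bound equals `S(0)`.
  set g : ℝ → ℝ := fun t => (t + 1 / 2 - 1 / mathieuS 0) * (t + a) - (4 * t + 1) / 12 with hg
  -- Any real `a` is allowed; starting at `max 0 (-a)` keeps the zero to the right of both the
  -- origin and the pole `t = -a`.
  set t₀ := max 0 (-a) with ht₀
  have hZi : 1 / mathieuS 0 < 1 / 2 := by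
    rw [div_lt_div_iff₀ hZpos (by norm_num)]; norm_num at *; linarith
  have hg0 : g t₀ < 0 := by
    rcases le_total a 0 with h0 | h0
    · have : t₀ = -a := max_eq_right (by linarith)
      rw [this]
      simp only [hg, neg_add_cancel, mul_zero]
      linarith
    · have : t₀ = 0 := max_eq_left (by linarith)
      rw [this]
      have e : mathieuA * (1 / 2 - 1 / mathieuS 0) = 1 / 12 := by
        field_simp
        linarith
      have := mul_lt_mul_of_pos_right ha (by linarith : 0 < 1 / 2 - 1 / mathieuS 0)
      simp only [hg]
      linarith
  have ht0 : 0 ≤ t₀ := le_max_left _ _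
  have hta : 0 ≤ t₀ + a := by linarith [le_max_right 0 (-a)]
  have hg1 : 0 ≤ g (t₀ + 1) := by
    have h1 : (t₀ + 1) * 1 ≤ (t₀ + 1 + 1 / 2 - 1 / mathieuS 0) * (t₀ + 1 + a) := by
      gcongr <;> linarith
    simp only [hg]
    linarith
  have hcont : ContinuousOn g (Set.Icc t₀ (t₀ + 1)) := by
    simp only [hg]; fun_prop
  obtain ⟨t, ⟨ht1, ht2⟩, ht3⟩ :=
    intermediate_value_Icc (by linarith : t₀ ≤ t₀ + 1) hcont ⟨hg0.le, hg1⟩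
  have ht4 : t₀ < t := lt_of_le_of_ne ht1 (by rintro rfl; linarith)
  have htpos : 0 < t := by linarith
  have hta' : 0 < t + a := by linarith
  have hr := h (√t) (Real.sqrt_pos.2 htpos)
  have hle := mathieuS_le_zero (√t)
  have hval : mathieuBound a (√t) = mathieuS 0 := by
    have h5 : t + 1 / 2 - (4 * t + 1) / 12 * (t + a)⁻¹ = 1 / mathieuS 0 := by
      rw [← div_eq_mul_inv, sub_eq_iff_eq_add, ← sub_eq_iff_eq_add', eq_div_iff hta'.ne']
      simp only [hg] at ht3
      linarith
    unfold mathieuBound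
    rw [Real.sq_sqrt htpos.le, h5, one_div_one_div]
  linarith

theorem le_of_forall_lt_mathieuBound {b : ℝ}
    (h : ∀ r : ℝ, 0 < r → mathieuS r < mathieuBound b r) : b ≤ 13 / 30 := by
  by_contra! hb
  have hb' : 0 < b - 13 / 30 := by linarith
  have hpos : 0 < 8 / 15 / (b - 13 / 30) := by positivity
  -- With this `r ^ 2`, `(8/15) / r ^ 2 = b - 13/30`, so the parameter `13/30 + (8/15) / (r ^ 2 +
  -- 1/2)` is below `b`.
  have h1 := h (√(8 / 15 / (b - 13 / 30))) (Real.sqrt_pos.2 hpos)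
  have h2 := mathieuBound_lt_mathieuS_of_sq (√(8 / 15 / (b - 13 / 30)))
  refine lt_asymm (h1.trans (mathieuBound_anti (le_add_of_nonneg_right (by positivity)) ?_ _)) h2
  rw [Real.sq_sqrt hpos.le, ← lt_sub_iff_add_lt', div_lt_iff₀ (by positivity), mul_add,
    mul_div_cancel₀ _ hb'.ne']
  linarith

theorem theorem1 :
    (∀ r : ℝ, 0 < r →
      Summable (mathieuTerm r) ∧
      mathieuBound mathieuA r < mathieuS r ∧
      mathieuS r < mathieuBound (13 / 30) r) ∧
    (∀ a : ℝ, (∀ r : ℝ, 0 < r → mathieuBound a r < mathieuS r) → mathieuA ≤ a) ∧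
    (∀ b : ℝ, (∀ r : ℝ, 0 < r → mathieuS r < mathieuBound b r) → b ≤ 13 / 30) ∧
    (0.9915168156 ≤ mathieuA ∧ mathieuA < 0.9915168157) := by
  refine ⟨fun r hr => ⟨summable_mathieuTerm r, ?_, mathieuS_lt_mathieuBound hr⟩,
    fun a => mathieuA_le_of_forall_lt, fun b => le_of_forall_lt_mathieuBound,
    le_mathieuA, mathieuA_lt⟩
  rcases le_total (r ^ 2) (1 / 2) with h | h
  · exact mathieuBound_lt_mathieuS_of_sq_le hr h
  · exact mathieuBound_lt_mathieuS_of_le_sq h
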